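/- Let $\mathbb D$ be the open unit disk in $\mathbb C$, let $dA$ be the normalized Lebesgue area measure on $\mathbb D$, and let $H(\mathbb D)$ be the space of analytic functions $f(z)=\sum_{n\ge 0}\hat f(n)z^n$ on $\mathbb D$. For $\alpha\in\mathbb R$ let $$\mathfrak B^1_{\log^\alpha}=\Big\{f\in H(\mathbb D):\int_{\mathbb D}|f'(z)|\,\log^\alpha\frac{2}{1-|z|}\,dA(z)<\infty\Big\},\qquad \mathfrak B^1=\mathfrak B^1_{\log^0}=\Big\{f\in H(\mathbb D):\int_{\mathbb D}|f'(z)|\,dA(z)<\infty\Big\},$$ and $$\mathfrak B^1_{\mathrm{logg}}=\Big\{f\in H(\mathbb D):\int_{\mathbb D}|f'(z)|\,\log\log\frac{4}{1-|z|}\,dA(z)<\infty\Big\}.$$ For $f\in H(\mathbb D)$ the Libera transform of $f$ is $$\mathcal L f(z)=\int_0^1 f\big(t+(1-t)z\big)\,dt,\qquad z\in\mathbb D.$$ We say that $\mathcal L f$ is well defined if $\sum_{n\ge 0}|\hat f(n)|/(n+1)<\infty$, the above integral converges absolutely for every $z\in\mathbb D$, and $$\mathcal L f(z)=\sum_{n=0}^\infty\Big(\sum_{k=n}^\infty\frac{\hat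 f(k)}{k+1}\Big)z^n\qquad(z\in\mathbb D);$$ $\mathcal L$ is well defined on a set of functions if $\mathcal L f$ is well defined for each $f$ in it. **Theorem.** (a) If $\alpha>0$, then $\mathcal L$ is well defined on $\mathfrak B^1_{\log^\alpha}$ and maps this space into $\mathfrak B^1_{\log^{\alpha-1}}$. (b) $\mathcal L$ is well defined on $\mathfrak B^1_{\mathrm{logg}}$ and maps this space into $\mathfrak B^1_{\log^{-1}}$. (c) $\mathcal L$ is well defined on $\mathfrak B^1$ and maps it into $\mathfrak B^1_{\log^\alpha}$ for all $\alpha<-1$. -/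

import Mathlib

namespace LiberaBloch

open MeasureTheory

/-- The open unit disk of the complex plane. -/
def unitDisk : Set ℂ := Metric.ball (0 : ℂ) 1

/-- Normalized Lebesgue area measure `dA` on the unit disk (total mass one). -/
noncomputable def areaMeasure : Measure ℂ :=
  ENNReal.ofReal (Real.pi⁻¹) • (volume.restrict unitDisk)

/-- The functions analytic in the unit disk whose derivative is integrable on the disk against
`w |z| dA(z)`. A function on the disk is given by a function `ℂ → ℂ`, whose values off the disk
play no role. -/
def weightedBlochOne (w : ℝ → ℝ) : Set (ℂ → ℂ) :=
  {f | DifferentiableOn ℂ f unitDisk ∧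
    Integrable (fun z : ℂ => ‖deriv f z‖ * w ‖z‖) areaMeasure}

/-- The space `𝔅¹_{log^α}`: weight `log^α (2 / (1 - |z|))`. -/
noncomputable def blochOneLog (α : ℝ) : Set (ℂ → ℂ) :=
  weightedBlochOne (fun r => (Real.log (2 / (1 - r))) ^ α)

/-- The space `𝔅¹`: weight one. -/
def blochOne : Set (ℂ → ℂ) := weightedBlochOne (fun _ => 1)

/-- The space `𝔅¹_{logg}`: weight `log log (4 / (1 - |z|))`. -/
noncomputable def blochOneLogg : Set (ℂ → ℂ) :=
  weightedBlochOne (fun r => Real.log (Real.log (4 / (1 - r))))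

/-- The `n`-th Taylor coefficient of `f` at the origin. -/
noncomputable def taylorCoeff (f : ℂ → ℂ) (n : ℕ) : ℂ :=
  iteratedDeriv n f 0 / (n.factorial : ℂ)

/-- The Libera transform `ℒ f (z) = ∫₀¹ f (t + (1 - t) z) dt`. -/
noncomputable def libera (f : ℂ → ℂ) (z : ℂ) : ℂ :=
  ∫ t in (0 : ℝ)..1, f ((t : ℂ) + (1 - (t : ℂ)) * z)

/-- The Libera transform of `f` is well defined: `∑ |f̂ n| / (n + 1) < ∞`, the defining integral
exists at every point of the disk, and it is the sum of the power series
`∑ₙ (∑_{k ≥ n} f̂ k / (k + 1)) zⁿ`. -/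
def LiberaWellDefined (f : ℂ → ℂ) : Prop :=
  Summable (fun n : ℕ => ‖taylorCoeff f n‖ / ((n : ℝ) + 1)) ∧
  ∀ z ∈ unitDisk,
    IntervalIntegrable (fun t : ℝ => f ((t : ℂ) + (1 - (t : ℂ)) * z)) volume 0 1 ∧
    HasSum (fun n : ℕ =>
      (∑' k : ℕ, taylorCoeff f (n + k) / (((n + k : ℕ) : ℂ) + 1)) * z ^ n) (libera f z)

end LiberaBloch

open MeasureTheory Set
open scoped ENNReal

namespace LiberaBloch

/-! All the source weights are bounded below on the disk, so every `f` considered has `f'` in the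
Bergman space `A¹`. A Hardy-type inequality (`summable_taylorCoeff_div`) then gives `∑ |f̂ n| / (n +
1) < ∞`. This justifies integrating the Taylor series termwise along the segment from `z` to `1`,
rearranging the result, and differentiating under the integral.

For the mapping properties, `(ℒf)'(z) = ∫ (1 - t) f'(t + (1 - t) z) dt`. Tonelli and the
substitution `ζ = t + (1 - t) z`, whose Jacobian is `(1 - t)²`, bound `∫ |(ℒf)'| w` by `∫ |f'(ζ)|
K(ζ)`, where `K(ζ) = ∫ (1 - t)⁻¹ w(|z|) dt` over those `t` with `z = (ζ - t)/(1 - t)` in the disk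
(`lintegral_mul_liberaKernel`). It remains to prove `K ≤ C v` for the source weight `v`
(`libera_mem_of_liberaKernel_le`).

Let `δ = 1 - |ζ|` and `w = log^β (2/(1 - |z|))`. Only `t < 1 - δ/2` contribute, and there `1 - |z| ≤
δ/(1 - t)`. For `β ≤ 0` this bounds `K` by a multiple of `∫ (1 - t)⁻¹ log^β (4(1 - t)/δ) dt`, which
is `∫ s^β ds` from `log 2` to `log (4/δ)`: of order `log^(β+1)` if `β > -1`, `log log` if `β = -1`,
bounded if `β < -1`. For `β > 0` a lower bound on `1 - |z|` is needed instead, and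
`le_one_sub_norm_div` provides it. -/

/-! ### Taylor coefficients and a Hardy-type inequality. -/

lemma taylorCoeff_eq_cauchyPowerSeries {g : ℂ → ℂ} (hg : DifferentiableOn ℂ g unitDisk) {r : ℝ}
    (hr0 : 0 < r) (hr1 : r < 1) (n : ℕ) :
    taylorCoeff g n = cauchyPowerSeries g 0 r n (fun _ => 1) := by
  have hd : DiffContOnCl ℂ g (Metric.ball 0 r) := by
    apply DifferentiableOn.diffContOnCl
    rw [closure_ball _ hr0.ne']
    exact hg.mono (Metric.closedBall_subset_ball hr1)
  have h := (DiffContOnCl.hasFPowerSeriesOnBall (R := ⟨r, hr0.le⟩) hd hr0).factorial_smul 1 n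
  rw [iteratedFDeriv_apply_eq_iteratedDeriv_mul_prod, Finset.prod_const_one, one_smul,
    nsmul_eq_mul] at h
  rw [taylorCoeff, ← h, mul_div_cancel_left₀ _ (by exact_mod_cast n.factorial_ne_zero)]
  rfl

lemma polarCoord_symm_eq_circleMap (r θ : ℝ) :
    Complex.polarCoord.symm (r, θ) = circleMap 0 r θ := by
  rw [Complex.polarCoord_symm_apply, circleMap, Complex.exp_mul_I]
  simp

/-- Cauchy's estimate of a Taylor coefficient by an integral mean. -/
lemma ofReal_norm_taylorCoeff_mul_pow_le {g : ℂ → ℂ} (hg : DifferentiableOn ℂ g unitDisk) {r : ℝ}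
    (hr0 : 0 < r) (hr1 : r < 1) (n : ℕ) :
    ENNReal.ofReal (‖taylorCoeff g n‖ * r ^ n) ≤
      ∫⁻ θ in Ioo (-Real.pi) Real.pi, ‖g (Complex.polarCoord.symm (r, θ))‖ₑ := by
  have hcont : Continuous fun θ : ℝ => ‖g (circleMap 0 r θ)‖ := by
    apply Continuous.norm
    refine hg.continuousOn.comp_continuous (continuous_circleMap 0 r) fun θ => ?_
    simpa [unitDisk, abs_of_pos hr0] using hr1
  have hper : Function.Periodic (fun θ : ℝ => ‖g (circleMap 0 r θ)‖) (2 * Real.pi) := by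
    intro θ
    simp only [periodic_circleMap 0 r θ]
  have h1 : ‖taylorCoeff g n‖ * r ^ n ≤ ∫ θ in (-Real.pi)..Real.pi, ‖g (circleMap 0 r θ)‖ := by
    have h2 := norm_cauchyPowerSeries_le g 0 r n
    have h3 : ‖taylorCoeff g n‖ ≤ ‖cauchyPowerSeries g 0 r n‖ := by
      rw [taylorCoeff_eq_cauchyPowerSeries hg hr0 hr1]
      exact ((cauchyPowerSeries g 0 r n).le_opNorm (fun _ => 1)).trans_eq (by simp)
    have h4 := hper.intervalIntegral_add_eq (-Real.pi) 0
    rw [show -Real.pi + 2 * Real.pi = Real.pi by ring, zero_add] at h4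
    have hI : 0 ≤ ∫ θ in (0 : ℝ)..2 * Real.pi, ‖g (circleMap 0 r θ)‖ :=
      intervalIntegral.integral_nonneg Real.two_pi_pos.le fun _ _ => norm_nonneg _
    -- The normalization of the mean is discarded, since only summability is wanted later.
    have hpi : (2 * Real.pi)⁻¹ ≤ 1 := inv_le_one_of_one_le₀ (by linarith [Real.pi_gt_three])
    rw [h4]
    rw [abs_of_pos hr0] at h2
    calc ‖taylorCoeff g n‖ * r ^ n
        ≤ (((2 * Real.pi)⁻¹ * ∫ θ in (0 : ℝ)..2 * Real.pi, ‖g (circleMap 0 r θ)‖) * r⁻¹ ^ n)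
            * r ^ n := by gcongr; exact h3.trans h2
      _ = (2 * Real.pi)⁻¹ * ∫ θ in (0 : ℝ)..2 * Real.pi, ‖g (circleMap 0 r θ)‖ := by
          rw [mul_assoc, ← mul_pow, inv_mul_cancel₀ hr0.ne', one_pow, mul_one]
      _ ≤ _ := mul_le_of_le_one_left hI hpi
  refine (ENNReal.ofReal_le_ofReal h1).trans ?_
  have hpi : -Real.pi ≤ Real.pi := by linarith [Real.pi_pos]
  rw [intervalIntegral.integral_of_le hpi, ofReal_integral_eq_lintegral_ofReal
    ((hcont.intervalIntegrable _ _).1) (Filter.Eventually.of_forall fun _ => norm_nonneg _),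
    ← restrict_Ioo_eq_restrict_Ioc]
  simp only [polarCoord_symm_eq_circleMap, ofReal_norm]
  exact le_rfl

lemma lintegral_Ioo_pow_mul_one_sub (n : ℕ) :
    ∫⁻ r in Ioo (0 : ℝ) 1, ENNReal.ofReal (r ^ n * (1 - r)) =
      ENNReal.ofReal (1 / ((n + 1) * (n + 2))) := by
  rw [restrict_Ioo_eq_restrict_Ioc, ← ofReal_integral_eq_lintegral_ofReal,
    ← intervalIntegral.integral_of_le zero_le_one]
  · congr 1
    simp only [mul_sub, mul_one, ← pow_succ]
    rw [intervalIntegral.integral_sub (by simp) (by simp), integral_pow, integral_pow]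
    push_cast
    field_simp
    simp
    ring
  · change IntegrableOn _ _ _
    rw [← intervalIntegrable_iff_integrableOn_Ioc_of_le zero_le_one]
    exact (by fun_prop : Continuous fun r : ℝ => r ^ n * (1 - r)).intervalIntegrable _ _
  · filter_upwards [ae_restrict_mem measurableSet_Ioc] with r hr
    exact mul_nonneg (pow_nonneg hr.1.le _) (by linarith [hr.2])

lemma lintegral_polar_le {G : ℂ → ℝ≥0∞} (hG : Measurable G) :
    ∫⁻ r in Ioo (0 : ℝ) 1, ENNReal.ofReal r *
        ∫⁻ θ in Ioo (-Real.pi) Real.pi, G (Complex.polarCoord.symm (r, θ)) ≤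
      ∫⁻ z in unitDisk, G z := by
  have hm : Measurable fun p : ℝ × ℝ => G (Complex.polarCoord.symm p) := by
    refine hG.comp ?_
    have h : (fun p : ℝ × ℝ => Complex.polarCoord.symm p) =
        fun p => p.1 * (Real.cos p.2 + Real.sin p.2 * Complex.I) :=
      funext Complex.polarCoord_symm_apply
    change Measurable fun p : ℝ × ℝ => Complex.polarCoord.symm p
    rw [h]
    fun_prop
  have hball : MeasurableSet unitDisk := Metric.isOpen_ball.measurableSet
  calc ∫⁻ r in Ioo (0 : ℝ) 1, ENNReal.ofReal r *
        ∫⁻ θ in Ioo (-Real.pi) Real.pi, G (Complex.polarCoord.symm (r, θ))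
      = ∫⁻ r in Ioo (0 : ℝ) 1, ∫⁻ θ in Ioo (-Real.pi) Real.pi,
          ENNReal.ofReal r * G (Complex.polarCoord.symm (r, θ)) := by
        refine lintegral_congr fun r => ?_
        rw [lintegral_const_mul]
        exact hm.comp (by fun_prop)
    _ = ∫⁻ p in Ioo (0 : ℝ) 1 ×ˢ Ioo (-Real.pi) Real.pi,
          ENNReal.ofReal p.1 * G (Complex.polarCoord.symm p) := by
        rw [Measure.volume_eq_prod, setLIntegral_prod]
        exact ((by fun_prop : Measurable fun p : ℝ × ℝ => ENNReal.ofReal p.1).mul hm).aemeasurable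
    _ = ∫⁻ p in Ioo (0 : ℝ) 1 ×ˢ Ioo (-Real.pi) Real.pi,
          ENNReal.ofReal p.1 • unitDisk.indicator G (Complex.polarCoord.symm p) := by
        refine setLIntegral_congr_fun (measurableSet_Ioo.prod measurableSet_Ioo) fun p hp => ?_
        have : Complex.polarCoord.symm p ∈ unitDisk := by
          rw [show p = (p.1, p.2) from rfl, polarCoord_symm_eq_circleMap]
          simpa [unitDisk, abs_of_pos hp.1.1] using hp.1.2
        simp only [indicator_of_mem this, smul_eq_mul]
    _ ≤ ∫⁻ p in polarCoord.target,
          ENNReal.ofReal p.1 • unitDisk.indicator G (Complex.polarCoord.symm p) := by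
        refine lintegral_mono_set ?_
        exact prod_mono Ioo_subset_Ioi_self le_rfl
    _ = ∫⁻ z in unitDisk, G z := by
        rw [Complex.lintegral_comp_polarCoord_symm, lintegral_indicator hball]

/-- The Taylor coefficients of a function in the Bergman space `A¹`. -/
lemma summable_norm_taylorCoeff_of_lintegral {g : ℂ → ℂ} (hg : DifferentiableOn ℂ g unitDisk)
    (hm : Measurable g) (hfin : ∫⁻ z in unitDisk, ‖g z‖ₑ ≠ ∞) :
    Summable fun n : ℕ => ‖taylorCoeff g n‖ * (1 / ((2 * n + 2) * (2 * n + 3)) : ℝ) := by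
  have key : ∑' n : ℕ, ENNReal.ofReal (‖taylorCoeff g n‖ * (1 / ((2 * n + 2) * (2 * n + 3)) : ℝ))
      ≤ ∫⁻ z in unitDisk, ‖g z‖ₑ := by
    refine le_trans ?_ (lintegral_polar_le hm.enorm)
    calc ∑' n : ℕ, ENNReal.ofReal (‖taylorCoeff g n‖ * (1 / ((2 * n + 2) * (2 * n + 3)) : ℝ))
        = ∑' n : ℕ, ∫⁻ r in Ioo (0 : ℝ) 1,
            ENNReal.ofReal ‖taylorCoeff g n‖ * ENNReal.ofReal (r ^ (2 * n + 1) * (1 - r)) := by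
          refine tsum_congr fun n => ?_
          rw [lintegral_const_mul _ (by fun_prop), lintegral_Ioo_pow_mul_one_sub,
            ENNReal.ofReal_mul (norm_nonneg _)]
          push_cast
          ring_nf
      _ = ∫⁻ r in Ioo (0 : ℝ) 1, ∑' n : ℕ,
            ENNReal.ofReal ‖taylorCoeff g n‖ * ENNReal.ofReal (r ^ (2 * n + 1) * (1 - r)) := by
          rw [lintegral_tsum]
          intro n
          fun_prop
      _ ≤ _ := by
          refine setLIntegral_mono' measurableSet_Ioo fun r hr => ?_
          have h1r : 0 < 1 - r := by linarith [hr.2]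
          set M := ∫⁻ θ in Ioo (-Real.pi) Real.pi, ‖g (Complex.polarCoord.symm (r, θ))‖ₑ
          -- Split `r^(2n+1) (1 - r)` as `r · r^n · r^n (1 - r)`: Cauchy's estimate absorbs the
          -- first `r^n`, and the remaining `r^n (1 - r)` sum to `1`.
          calc ∑' n : ℕ,
              ENNReal.ofReal ‖taylorCoeff g n‖ * ENNReal.ofReal (r ^ (2 * n + 1) * (1 - r))
              ≤ ∑' n : ℕ, (ENNReal.ofReal r * M) * ENNReal.ofReal (r ^ n * (1 - r)) := by
                refine ENNReal.tsum_le_tsum fun n => ?_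
                have := ofReal_norm_taylorCoeff_mul_pow_le hg hr.1 hr.2 n
                calc _ = ENNReal.ofReal r * ENNReal.ofReal (‖taylorCoeff g n‖ * r ^ n)
                      * ENNReal.ofReal (r ^ n * (1 - r)) := by
                      have := hr.1.le
                      rw [← ENNReal.ofReal_mul (by positivity), ← ENNReal.ofReal_mul this,
                        ← ENNReal.ofReal_mul (by positivity)]
                      congr 1
                      ring
                  _ ≤ _ := by gcongr
            _ = ENNReal.ofReal r * M := by
                rw [ENNReal.tsum_mul_left, ← ENNReal.ofReal_tsum_of_nonneg
                  (fun n => mul_nonneg (pow_nonneg hr.1.le _) h1r.le)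
                  ((summable_geometric_of_lt_one hr.1.le hr.2).mul_right _),
                  tsum_mul_right, tsum_geometric_of_lt_one hr.1.le hr.2,
                  inv_mul_cancel₀ h1r.ne', ENNReal.ofReal_one, mul_one]
  have := ENNReal.summable_toReal (ne_top_of_le_ne_top hfin key)
  refine this.congr fun n => ?_
  rw [ENNReal.toReal_ofReal (by positivity)]

/-- Hardy's inequality for functions with derivative in the Bergman space `A¹`. -/
lemma summable_taylorCoeff_div {f : ℂ → ℂ} (hf : DifferentiableOn ℂ f unitDisk)
    (hfin : ∫⁻ z in unitDisk, ‖deriv f z‖ₑ ≠ ∞) :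
    Summable fun n : ℕ => ‖taylorCoeff f n‖ / ((n : ℝ) + 1) := by
  have h := summable_norm_taylorCoeff_of_lintegral (hf.deriv Metric.isOpen_ball)
    (measurable_deriv f) hfin
  rw [← summable_nat_add_iff 1]
  -- With the factor `n + 1` gained from differentiation, the constant `6` turns the weight into `3
  -- / (2n + 3)`, which dominates `1 / (n + 2)`.
  refine Summable.of_nonneg_of_le (fun n => by positivity) (fun n => ?_) (h.mul_left 6)
  have : taylorCoeff (deriv f) n = (n + 1) * taylorCoeff f (n + 1) := by
    have : (n.factorial : ℂ) ≠ 0 := by exact_mod_cast n.factorial_ne_zero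
    have : (n + 1 : ℂ) ≠ 0 := by exact_mod_cast n.succ_ne_zero
    rw [taylorCoeff, taylorCoeff, iteratedDeriv_succ', Nat.factorial_succ]
    push_cast
    field_simp
  rw [this, norm_mul, show (n + 1 : ℂ) = ((n + 1 : ℕ) : ℂ) by push_cast; rfl, Complex.norm_natCast]
  push_cast
  rw [div_eq_mul_one_div, show 6 * (((n : ℝ) + 1) * ‖taylorCoeff f (n + 1)‖ *
    (1 / ((2 * n + 2) * (2 * n + 3)))) = ‖taylorCoeff f (n + 1)‖ * (3 / (2 * n + 3)) by
    field_simp; ring]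
  gcongr ?_ * ?_
  rw [div_le_div_iff₀ (by positivity) (by positivity)]
  have : (0 : ℝ) ≤ n := by positivity
  linarith

/-! ### The Libera integral and its power series. -/

lemma integral_add_mul_pow {z : ℂ} (hz : z ≠ 1) (k : ℕ) :
    ∫ t in (0 : ℝ)..1, ((t : ℂ) + (1 - t) * z) ^ k =
      (∑ n ∈ Finset.range (k + 1), z ^ n) / (k + 1) := by
  have h1 : (1 : ℂ) - z ≠ 0 := sub_ne_zero.2 hz.symm
  have h2 : z - 1 ≠ 0 := sub_ne_zero.2 hz
  have hk : (k + 1 : ℂ) ≠ 0 := by exact_mod_cast k.succ_ne_zero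
  have hd : ∀ t ∈ uIcc (0 : ℝ) 1,
      HasDerivAt (fun t : ℝ => ((t : ℂ) + (1 - t) * z) ^ (k + 1) / ((k + 1) * (1 - z)))
        (((t : ℂ) + (1 - t) * z) ^ k) t := by
    intro t _
    have ht : HasDerivAt (fun t : ℝ => (t : ℂ)) 1 t := Complex.ofRealCLM.hasDerivAt
    have := (((ht.add ((ht.const_sub 1).mul_const z)).pow (k + 1)).div_const
      ((k + 1) * (1 - z)))
    refine this.congr_deriv ?_
    simp only [Pi.add_apply]
    push_cast
    field_simp
    ring
  rw [intervalIntegral.integral_eq_sub_of_hasDerivAt hd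
    ((by fun_prop : Continuous fun t : ℝ => ((t : ℂ) + (1 - t) * z) ^ k).intervalIntegrable _ _),
    geom_sum_eq hz]
  simp only [Complex.ofReal_one, Complex.ofReal_zero]
  field_simp
  ring

lemma norm_add_mul_le {t ρ : ℝ} (ht : t ∈ Ioo (0 : ℝ) 1) {z : ℂ} (hz : ‖z‖ ≤ ρ) :
    ‖(t : ℂ) + (1 - t) * z‖ ≤ t + (1 - t) * ρ := by
  have h1 : 0 ≤ 1 - t := by linarith [ht.2]
  calc ‖(t : ℂ) + (1 - t) * z‖ ≤ ‖(t : ℂ)‖ + ‖((1 - t : ℝ) : ℂ) * z‖ := by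
        push_cast; exact norm_add_le _ _
    _ = t + (1 - t) * ‖z‖ := by
        rw [norm_mul, Complex.norm_of_nonneg ht.1.le, Complex.norm_of_nonneg h1]
    _ ≤ _ := by gcongr

lemma add_mul_lt_one {t ρ : ℝ} (ht : t ∈ Ioo (0 : ℝ) 1) (hρ : ρ < 1) :
    t + (1 - t) * ρ < 1 := by
  nlinarith [ht.2]

lemma add_mul_mem_unitDisk {t : ℝ} (ht : t ∈ Ioo (0 : ℝ) 1) {z : ℂ} (hz : z ∈ unitDisk) :
    (t : ℂ) + (1 - t) * z ∈ unitDisk := by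
  simp only [unitDisk, Metric.mem_ball, dist_zero_right] at hz ⊢
  exact (norm_add_mul_le ht le_rfl).trans_lt (add_mul_lt_one ht hz)

lemma hasSum_taylorCoeff {f : ℂ → ℂ} (hf : DifferentiableOn ℂ f unitDisk) {z : ℂ}
    (hz : z ∈ unitDisk) : HasSum (fun n : ℕ => taylorCoeff f n * z ^ n) (f z) := by
  refine (Complex.hasSum_taylorSeries_on_ball hf hz).congr_fun fun n => ?_
  simp only [taylorCoeff, sub_zero, smul_eq_mul]
  ring

/-- A majorant of `t ↦ f (t + (1 - t) z)` for `‖z‖ ≤ ρ`. -/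
noncomputable def liberaMajorant (f : ℂ → ℂ) (ρ t : ℝ) : ℝ :=
  ∑' k : ℕ, ‖taylorCoeff f k‖ * (t + (1 - t) * ρ) ^ k

lemma summable_norm_taylorCoeff_mul_pow {f : ℂ → ℂ} (hf : DifferentiableOn ℂ f unitDisk) {x : ℝ}
    (hx0 : 0 ≤ x) (hx1 : x < 1) : Summable fun k : ℕ => ‖taylorCoeff f k‖ * x ^ k := by
  have hx : (x : ℂ) ∈ unitDisk := by
    simpa [unitDisk, abs_of_nonneg hx0] using hx1
  refine (hasSum_taylorCoeff hf hx).summable.norm.congr fun k => ?_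
  rw [norm_mul, norm_pow, Complex.norm_of_nonneg hx0]

lemma norm_le_liberaMajorant {f : ℂ → ℂ} (hf : DifferentiableOn ℂ f unitDisk) {t ρ : ℝ}
    (ht : t ∈ Ioo (0 : ℝ) 1) (hρ : ρ < 1) {z : ℂ} (hz : ‖z‖ ≤ ρ) :
    ‖f (t + (1 - t) * z)‖ ≤ liberaMajorant f ρ t := by
  have hzD : z ∈ unitDisk := by simpa [unitDisk] using hz.trans_lt hρ
  have h0 : 0 ≤ t + (1 - t) * ρ :=
    add_nonneg ht.1.le (mul_nonneg (by linarith [ht.2]) ((norm_nonneg z).trans hz))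
  rw [← (hasSum_taylorCoeff hf (add_mul_mem_unitDisk ht hzD)).tsum_eq]
  refine tsum_of_norm_bounded
    (summable_norm_taylorCoeff_mul_pow hf h0 (add_mul_lt_one ht hρ)).hasSum fun k => ?_
  rw [norm_mul, norm_pow]
  gcongr
  exact norm_add_mul_le ht hz

/-- The finite geometric sum is bounded by the full series. The resulting decay `1 / (k + 1)` is
what matches Hardy's inequality. -/
lemma integral_add_mul_pow_le {ρ : ℝ} (h0 : 0 ≤ ρ) (h1 : ρ < 1) (k : ℕ) :
    ∫ t in Ioo (0 : ℝ) 1, (t + (1 - t) * ρ) ^ k ≤ (1 - ρ)⁻¹ / (k + 1) := by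
  have hne : (ρ : ℂ) ≠ 1 := by exact_mod_cast h1.ne
  have h := integral_add_mul_pow hne k
  have h2 : ∫ t in (0 : ℝ)..1, (t + (1 - t) * ρ) ^ k =
      (∑ n ∈ Finset.range (k + 1), ρ ^ n) / (k + 1) := by
    have h3 : ∀ t : ℝ, ((t : ℂ) + (1 - t) * ρ) ^ k = (((t + (1 - t) * ρ) ^ k : ℝ) : ℂ) := by
      intro t; push_cast; rfl
    simp only [h3, intervalIntegral.integral_ofReal] at h
    exact_mod_cast h
  rw [restrict_Ioo_eq_restrict_Ioc, ← intervalIntegral.integral_of_le zero_le_one, h2]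
  gcongr
  rw [← tsum_geometric_of_lt_one h0 h1]
  exact (summable_geometric_of_lt_one h0 h1).sum_le_tsum _ fun n _ => pow_nonneg h0 n

lemma integrable_tsum_of_nonneg {α : Type*} [MeasurableSpace α] {μ : Measure α}
    {F : ℕ → α → ℝ} (hm : ∀ k, Measurable (F k)) (hpos : ∀ k, ∀ᵐ x ∂μ, 0 ≤ F k x)
    (hi : ∀ k, Integrable (F k) μ) (hs : Summable fun k => ∫ x, F k x ∂μ) :
    Integrable (fun x => ∑' k, F k x) μ := by
  refine ⟨(Measurable.tsum hm).aestronglyMeasurable, ?_⟩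
  rw [hasFiniteIntegral_iff_enorm]
  calc ∫⁻ x, ‖∑' k, F k x‖ₑ ∂μ ≤ ∫⁻ x, ∑' k, ‖F k x‖ₑ ∂μ :=
        lintegral_mono fun x => enorm_tsum_le_tsum_enorm
    _ = ∑' k, ENNReal.ofReal (∫ x, F k x ∂μ) := by
        rw [lintegral_tsum fun k => (hm k).enorm.aemeasurable]
        refine tsum_congr fun k => ?_
        rw [ofReal_integral_eq_lintegral_ofReal (hi k) (hpos k)]
        refine lintegral_congr_ae ?_
        filter_upwards [hpos k] with x hx
        rw [Real.enorm_of_nonneg hx]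
    _ < ∞ := by
        rw [← ENNReal.ofReal_tsum_of_nonneg (fun k => integral_nonneg_of_ae (hpos k)) hs]
        exact ENNReal.ofReal_lt_top

lemma integrable_norm_taylorCoeff_mul_pow (f : ℂ → ℂ) (ρ : ℝ) (k : ℕ) :
    Integrable (fun t : ℝ => ‖taylorCoeff f k‖ * (t + (1 - t) * ρ) ^ k)
      (volume.restrict (Ioo (0 : ℝ) 1)) := by
  have : IntegrableOn (fun t : ℝ => ‖taylorCoeff f k‖ * (t + (1 - t) * ρ) ^ k) (Icc 0 1) :=
    (by fun_prop : Continuous fun t : ℝ =>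
      ‖taylorCoeff f k‖ * (t + (1 - t) * ρ) ^ k).integrableOn_Icc
  exact this.mono_set Ioo_subset_Icc_self

lemma summable_integral_norm_taylorCoeff_mul_pow {f : ℂ → ℂ}
    (hs : Summable fun n : ℕ => ‖taylorCoeff f n‖ / ((n : ℝ) + 1)) {ρ : ℝ}
    (h0 : 0 ≤ ρ) (h1 : ρ < 1) :
    Summable fun k : ℕ => ∫ t in Ioo (0 : ℝ) 1, ‖taylorCoeff f k‖ * (t + (1 - t) * ρ) ^ k := by
  refine Summable.of_nonneg_of_le (fun k => ?_) (fun k => ?_) (hs.mul_left (1 - ρ)⁻¹)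
  · refine setIntegral_nonneg measurableSet_Ioo fun t ht => ?_
    have := ht.1
    have := sub_pos.2 ht.2
    positivity
  · rw [integral_const_mul]
    calc _ ≤ ‖taylorCoeff f k‖ * ((1 - ρ)⁻¹ / (k + 1)) := by
          gcongr; exact integral_add_mul_pow_le h0 h1 k
      _ = _ := by ring

lemma integrable_liberaMajorant {f : ℂ → ℂ}
    (hs : Summable fun n : ℕ => ‖taylorCoeff f n‖ / ((n : ℝ) + 1)) {ρ : ℝ}
    (h0 : 0 ≤ ρ) (h1 : ρ < 1) :
    Integrable (liberaMajorant f ρ) (volume.restrict (Ioo (0 : ℝ) 1)) := by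
  refine integrable_tsum_of_nonneg (fun k => by fun_prop) (fun k => ?_)
    (integrable_norm_taylorCoeff_mul_pow f ρ)
    (summable_integral_norm_taylorCoeff_mul_pow hs h0 h1)
  filter_upwards [ae_restrict_mem measurableSet_Ioo] with t ht
  have := ht.1
  have := sub_pos.2 ht.2
  positivity

lemma aestronglyMeasurable_comp_add_mul {g : ℂ → ℂ} (hg : ContinuousOn g unitDisk) {z : ℂ}
    (hz : z ∈ unitDisk) :
    AEStronglyMeasurable (fun t : ℝ => g (t + (1 - t) * z)) (volume.restrict (Ioo (0 : ℝ) 1)) := by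
  refine ContinuousOn.aestronglyMeasurable ?_ measurableSet_Ioo
  exact hg.comp (by fun_prop) fun t ht => add_mul_mem_unitDisk ht hz

lemma integrable_comp_add_mul {f : ℂ → ℂ} (hf : DifferentiableOn ℂ f unitDisk)
    (hs : Summable fun n : ℕ => ‖taylorCoeff f n‖ / ((n : ℝ) + 1)) {z : ℂ} (hz : z ∈ unitDisk) :
    Integrable (fun t : ℝ => f (t + (1 - t) * z)) (volume.restrict (Ioo (0 : ℝ) 1)) := by
  have hz1 : ‖z‖ < 1 := by simpa [unitDisk] using hz
  refine (integrable_liberaMajorant hs (norm_nonneg z) hz1).mono'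
    (aestronglyMeasurable_comp_add_mul hf.continuousOn hz) ?_
  filter_upwards [ae_restrict_mem measurableSet_Ioo] with t ht
  exact norm_le_liberaMajorant hf ht hz1 le_rfl

lemma libera_eq_integral_Ioo (f : ℂ → ℂ) (z : ℂ) :
    libera f z = ∫ t in Ioo (0 : ℝ) 1, f (t + (1 - t) * z) := by
  rw [libera, intervalIntegral.integral_of_le zero_le_one, restrict_Ioo_eq_restrict_Ioc]

lemma hasSum_libera {f : ℂ → ℂ} (hf : DifferentiableOn ℂ f unitDisk)
    (hs : Summable fun n : ℕ => ‖taylorCoeff f n‖ / ((n : ℝ) + 1)) {z : ℂ} (hz : z ∈ unitDisk) :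
    HasSum (fun k : ℕ => taylorCoeff f k / (k + 1) * ∑ n ∈ Finset.range (k + 1), z ^ n)
      (libera f z) := by
  have hz1 : ‖z‖ < 1 := by simpa [unitDisk] using hz
  have hne : z ≠ 1 := by rintro rfl; simp at hz1
  have hint : ∀ k : ℕ, Integrable (fun t : ℝ => taylorCoeff f k * ((t : ℂ) + (1 - t) * z) ^ k)
      (volume.restrict (Ioo (0 : ℝ) 1)) := fun k =>
    IntegrableOn.mono_set (by fun_prop : Continuous fun t : ℝ =>
      taylorCoeff f k * ((t : ℂ) + (1 - t) * z) ^ k).integrableOn_Icc Ioo_subset_Icc_self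
  have hsum : Summable fun k : ℕ => ∫ t in Ioo (0 : ℝ) 1,
      ‖taylorCoeff f k * ((t : ℂ) + (1 - t) * z) ^ k‖ := by
    refine Summable.of_nonneg_of_le (fun k => integral_nonneg fun t => norm_nonneg _)
      (fun k => ?_) (summable_integral_norm_taylorCoeff_mul_pow hs (norm_nonneg z) hz1)
    refine setIntegral_mono_on (hint k).norm (integrable_norm_taylorCoeff_mul_pow f _ k)
      measurableSet_Ioo fun t ht => ?_
    rw [norm_mul, norm_pow]
    gcongr
    exact norm_add_mul_le ht le_rfl
  have h := hasSum_integral_of_summable_integral_norm hint hsum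
  have e : ∫ t in Ioo (0 : ℝ) 1, ∑' k : ℕ, taylorCoeff f k * ((t : ℂ) + (1 - t) * z) ^ k =
      libera f z := by
    rw [libera_eq_integral_Ioo]
    exact setIntegral_congr_fun measurableSet_Ioo fun t ht =>
      (hasSum_taylorCoeff hf (add_mul_mem_unitDisk ht hz)).tsum_eq
  rw [e] at h
  refine h.congr_fun fun k => ?_
  rw [integral_const_mul, restrict_Ioo_eq_restrict_Ioc,
    ← intervalIntegral.integral_of_le zero_le_one, integral_add_mul_pow hne]
  ring

lemma liberaWellDefined_of_summable {f : ℂ → ℂ} (hf : DifferentiableOn ℂ f unitDisk)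
    (hs : Summable fun n : ℕ => ‖taylorCoeff f n‖ / ((n : ℝ) + 1)) : LiberaWellDefined f := by
  refine ⟨hs, fun z hz => ⟨?_, ?_⟩⟩
  · rw [intervalIntegrable_iff_integrableOn_Ioo_of_le zero_le_one]
    exact integrable_comp_add_mul hf hs hz
  have hz1 : ‖z‖ < 1 := by simpa [unitDisk] using hz
  set b : ℕ → ℂ := fun k => taylorCoeff f k / ((k : ℂ) + 1) with hb
  have hbs : Summable fun k => ‖b k‖ := by
    refine hs.congr fun k => ?_
    rw [hb]
    simp only [norm_div]
    rw [show (k + 1 : ℂ) = ((k + 1 : ℕ) : ℂ) by push_cast; rfl, Complex.norm_natCast]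
    push_cast; rfl
  -- Summing this array over rows gives the claimed power series, and over antidiagonals `n + j = k`
  -- gives the series of `hasSum_libera`; absolute summability identifies the two.
  set h : ℕ × ℕ → ℂ := fun p => b (p.1 + p.2) * z ^ p.1 with hh
  have hshift : ∀ n : ℕ, Summable fun j => ‖b (n + j)‖ := fun n => by
    simpa only [add_comm n] using (summable_nat_add_iff n).2 hbs
  have hsum : Summable h := by
    apply Summable.of_norm
    rw [summable_prod_of_nonneg fun p => norm_nonneg _]
    simp only [hh, norm_mul, norm_pow]
    refine ⟨fun n => (hshift n).mul_right _, ?_⟩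
    simp only [tsum_mul_right]
    refine Summable.of_nonneg_of_le (fun n => ?_) (fun n => ?_)
      ((summable_geometric_of_lt_one (norm_nonneg z) hz1).mul_left (∑' k, ‖b k‖))
    · exact mul_nonneg (tsum_nonneg fun _ => norm_nonneg _) (by positivity)
    · refine mul_le_mul_of_nonneg_right ?_ (by positivity)
      exact Summable.tsum_le_tsum_of_inj (fun j => n + j) (add_right_injective n)
        (fun _ _ => norm_nonneg _) (fun _ => le_rfl) (hshift n) hbs
  have h1 := hsum.hasSum.prod_fiberwise fun n => (hsum.prod_factor n).hasSum
  have h2 : ∑' p, h p = libera f z := by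
    rw [← (hasSum_libera hf hs hz).tsum_eq,
      ← (Finset.HasAntidiagonal.sigmaAntidiagonalEquivProd (A := ℕ)).tsum_eq]
    rw [Summable.tsum_sigma' (f := fun c => h (Finset.HasAntidiagonal.sigmaAntidiagonalEquivProd c))
      (fun n => (hasSum_fintype _).summable)
      ((Finset.HasAntidiagonal.sigmaAntidiagonalEquivProd (A := ℕ)).summable_iff.2 hsum)]
    refine tsum_congr fun k => ?_
    rw [tsum_fintype, Finset.mul_sum]
    rw [← Finset.Nat.sum_antidiagonal_eq_sum_range_succ_mk
      (fun p : ℕ × ℕ => taylorCoeff f k / ((k : ℂ) + 1) * z ^ p.1)]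
    rw [← Finset.sum_coe_sort (Finset.HasAntidiagonal.antidiagonal k)]
    refine Finset.sum_congr rfl fun p _ => ?_
    have := Finset.HasAntidiagonal.mem_antidiagonal.1 p.2
    simp only [Finset.HasAntidiagonal.sigmaAntidiagonalEquivProd_apply, hh, hb, this]
  rw [h2] at h1
  refine h1.congr_fun fun n => ?_
  simp only [hh, hb, tsum_mul_right]

/-! ### Differentiation under the integral. -/

/-- No separate majorant for `f'` is needed: Cauchy's estimate on circles of radius `ε` bounds the
integrand by `liberaMajorant f ρ t / ε`. -/
lemma hasDerivAt_libera {f : ℂ → ℂ} (hf : DifferentiableOn ℂ f unitDisk)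
    (hs : Summable fun n : ℕ => ‖taylorCoeff f n‖ / ((n : ℝ) + 1)) {z : ℂ} (hz : z ∈ unitDisk) :
    HasDerivAt (libera f) (∫ t in Ioo (0 : ℝ) 1, deriv f (t + (1 - t) * z) * (1 - t)) z := by
  have hz1 : ‖z‖ < 1 := by simpa [unitDisk] using hz
  have hopen : IsOpen unitDisk := Metric.isOpen_ball
  -- Two steps of length `ε` from `z` stay within `‖z‖ + 2 * ε = ρ < 1`.
  set ε : ℝ := (1 - ‖z‖) / 4 with hε
  have hε0 : 0 < ε := by rw [hε]; linarith
  set ρ : ℝ := (1 + ‖z‖) / 2 with hρ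
  have hρ1 : ρ < 1 := by rw [hρ]; linarith
  have hρ0 : 0 ≤ ρ := by rw [hρ]; positivity
  have hball : ∀ x ∈ Metric.ball z ε, ∀ y ∈ Metric.closedBall x ε, ‖y‖ ≤ ρ := by
    intro x hx y hy
    have h1 : ‖y - x‖ ≤ ε := by simpa [dist_eq_norm] using hy
    have h2 : ‖x - z‖ < ε := by simpa [dist_eq_norm] using hx
    have h3 : ‖y‖ ≤ ‖y - x‖ + ‖x - z‖ + ‖z‖ := by
      calc ‖y‖ = ‖(y - x) + (x - z) + z‖ := by ring_nf
        _ ≤ _ := norm_add₃_le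
    rw [hρ]; rw [hε] at h1 h2; linarith
  have hD : ∀ y : ℂ, ‖y‖ ≤ ρ → y ∈ unitDisk := fun y hy => by
    simpa [unitDisk] using hy.trans_lt hρ1
  have hder : ∀ t ∈ Ioo (0 : ℝ) 1, ∀ y ∈ unitDisk,
      HasDerivAt (fun y : ℂ => f (t + (1 - t) * y)) (deriv f (t + (1 - t) * y) * (1 - t)) y := by
    intro t ht y hy
    have h1 := (hf.differentiableAt (hopen.mem_nhds (add_mul_mem_unitDisk ht hy))).hasDerivAt
    have h2 : HasDerivAt (fun y : ℂ => (t : ℂ) + (1 - t) * y) (1 - t) y := by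
      simpa using ((hasDerivAt_id y).const_mul ((1 : ℂ) - t)).const_add (t : ℂ)
    exact HasDerivAt.comp y h1 h2
  have hfun : libera f = fun x => ∫ t in Ioo (0 : ℝ) 1, f (t + (1 - t) * x) :=
    funext (libera_eq_integral_Ioo f)
  rw [hfun]
  refine (hasDerivAt_integral_of_dominated_loc_of_deriv_le (Metric.ball_mem_nhds z hε0)
    (F' := fun x t => deriv f (t + (1 - t) * x) * (1 - t))
    (bound := fun t => liberaMajorant f ρ t / ε) ?_ (integrable_comp_add_mul hf hs hz) ?_ ?_
    ((integrable_liberaMajorant hs hρ0 hρ1).div_const ε) ?_).2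
  · filter_upwards [hopen.mem_nhds hz] with x hx
    exact aestronglyMeasurable_comp_add_mul hf.continuousOn hx
  · exact (aestronglyMeasurable_comp_add_mul (hf.deriv hopen).continuousOn hz).mul
      (by fun_prop : Continuous fun t : ℝ => (1 - t : ℂ)).aestronglyMeasurable
  · filter_upwards [ae_restrict_mem measurableSet_Ioo] with t ht x hx
    have hxD : x ∈ unitDisk := hD x (hball x hx x (Metric.mem_closedBall_self hε0.le))
    rw [← (hder t ht x hxD).deriv]
    refine Complex.norm_deriv_le_of_forall_mem_sphere_norm_le hε0 ?_ fun y hy => ?_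
    · apply DifferentiableOn.diffContOnCl
      rw [closure_ball _ hε0.ne']
      exact fun y hy => (hder t ht y (hD y (hball x hx y hy))).differentiableAt.differentiableWithinAt
    · exact norm_le_liberaMajorant hf ht hρ1 (hball x hx y (Metric.sphere_subset_closedBall hy))
  · filter_upwards [ae_restrict_mem measurableSet_Ioo] with t ht x hx
    exact hder t ht x (hD x (hball x hx x (Metric.mem_closedBall_self hε0.le)))

/-! ### Weighted spaces and reduction to a kernel bound. -/

lemma measurableSet_unitDisk : MeasurableSet unitDisk := Metric.isOpen_ball.measurableSet

lemma norm_lt_one_of_mem {z : ℂ} (hz : z ∈ unitDisk) : ‖z‖ < 1 := by simpa [unitDisk] using hz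

lemma mem_weightedBlochOne_iff {w : ℝ → ℝ} (hw : Measurable w)
    (hpos : ∀ r, 0 ≤ r → r < 1 → 0 ≤ w r) {f : ℂ → ℂ} :
    f ∈ weightedBlochOne w ↔ DifferentiableOn ℂ f unitDisk ∧
      ∫⁻ z in unitDisk, ‖deriv f z‖ₑ * ENNReal.ofReal (w ‖z‖) < ∞ := by
  have hm : Measurable fun z : ℂ => ‖deriv f z‖ * w ‖z‖ :=
    (measurable_deriv f).norm.mul (hw.comp measurable_norm)
  have hc : ENNReal.ofReal (Real.pi⁻¹) ≠ 0 := by simpa using Real.pi_pos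
  rw [weightedBlochOne, mem_ofPred_eq, areaMeasure,
    integrable_smul_measure hc ENNReal.ofReal_ne_top]
  refine and_congr_right fun _ => ?_
  have e : ∫⁻ z in unitDisk, ‖‖deriv f z‖ * w ‖z‖‖ₑ =
      ∫⁻ z in unitDisk, ‖deriv f z‖ₑ * ENNReal.ofReal (w ‖z‖) := by
    refine setLIntegral_congr_fun measurableSet_unitDisk fun z hz => ?_
    rw [enorm_mul, enorm_norm,
      Real.enorm_of_nonneg (hpos _ (norm_nonneg z) (norm_lt_one_of_mem hz))]
  rw [← e]
  exact ⟨fun h => h.2, fun h => ⟨hm.aestronglyMeasurable, h⟩⟩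

lemma lintegral_comp_add_mul {g : ℂ → ℝ≥0∞} (hg : Measurable g) {t : ℝ} (ht : t < 1) :
    ∫⁻ z, g (t + (1 - t) * z) = ENNReal.ofReal (((1 - t) ^ 2)⁻¹) * ∫⁻ z, g z := by
  have h0 : 1 - t ≠ 0 := (sub_pos.2 ht).ne'
  have h1 : ∫⁻ z, g (t + (1 - t) * z) = ∫⁻ y, g (t + y) ∂(Measure.map ((1 - t) • ·) volume) := by
    rw [lintegral_map (f := fun y => g (t + y)) (hg.comp (measurable_const_add _))
      (measurable_const_smul _)]
    refine lintegral_congr fun z => ?_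
    rw [Complex.real_smul]
    push_cast
    rfl
  rw [h1, Measure.map_addHaar_smul _ h0, lintegral_smul_measure, lintegral_add_left_eq_self,
    Complex.finrank_real_complex, abs_of_nonneg (by positivity), smul_eq_mul]

/-- The kernel which transports a weight `W` along the Libera transform. -/
noncomputable def liberaKernel (W : ℂ → ℝ≥0∞) (ζ : ℂ) : ℝ≥0∞ :=
  ∫⁻ t in Ioo (0 : ℝ) 1, ENNReal.ofReal ((1 - t)⁻¹) * W ((ζ - t) / (1 - t))

lemma lintegral_mul_liberaKernel {h W : ℂ → ℝ≥0∞} (hh : Measurable h) (hW : Measurable W) :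
    ∫⁻ z, (∫⁻ t in Ioo (0 : ℝ) 1, h (t + (1 - t) * z) * ENNReal.ofReal (1 - t)) * W z =
      ∫⁻ ζ, h ζ * liberaKernel W ζ := by
  calc ∫⁻ z, (∫⁻ t in Ioo (0 : ℝ) 1, h (t + (1 - t) * z) * ENNReal.ofReal (1 - t)) * W z
      = ∫⁻ z, ∫⁻ t in Ioo (0 : ℝ) 1, h (t + (1 - t) * z) * ENNReal.ofReal (1 - t) * W z := by
        refine lintegral_congr fun z => ?_
        rw [lintegral_mul_const]
        exact (hh.comp (by fun_prop)).mul (by fun_prop)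
    _ = ∫⁻ t in Ioo (0 : ℝ) 1, ∫⁻ z, h (t + (1 - t) * z) * ENNReal.ofReal (1 - t) * W z := by
        rw [lintegral_lintegral_swap]
        exact (((hh.comp (by fun_prop)).mul (by fun_prop)).mul
          (hW.comp measurable_fst)).aemeasurable
    _ = ∫⁻ t in Ioo (0 : ℝ) 1, ∫⁻ ζ,
          h ζ * (ENNReal.ofReal ((1 - t)⁻¹) * W ((ζ - t) / (1 - t))) := by
        refine setLIntegral_congr_fun measurableSet_Ioo fun t ht => ?_
        have h0 : 0 < 1 - t := sub_pos.2 ht.2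
        have h0' : (1 - t : ℂ) ≠ 0 := by exact_mod_cast h0.ne'
        have hm : Measurable fun ζ : ℂ =>
            h ζ * ENNReal.ofReal (1 - t) * W ((ζ - t) / (1 - t)) :=
          (hh.mul_const _).mul (hW.comp (by fun_prop))
        have := lintegral_comp_add_mul hm ht.2
        simp only [add_sub_cancel_left, mul_div_cancel_left₀ _ h0'] at this
        rw [this, ← lintegral_const_mul _ hm]
        refine lintegral_congr fun ζ => ?_
        -- Inverse Jacobian of the real planar dilation times the chain-rule factor.
        rw [show (1 - t)⁻¹ = ((1 - t) ^ 2)⁻¹ * (1 - t) by field_simp,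
          ENNReal.ofReal_mul (by positivity)]
        ring
    _ = ∫⁻ ζ, ∫⁻ t in Ioo (0 : ℝ) 1,
          h ζ * (ENNReal.ofReal ((1 - t)⁻¹) * W ((ζ - t) / (1 - t))) := by
        rw [lintegral_lintegral_swap]
        exact ((hh.comp measurable_snd).mul
          ((by fun_prop : Measurable fun p : ℝ × ℂ => ENNReal.ofReal ((1 - p.1)⁻¹)).mul
          (hW.comp (by fun_prop)))).aemeasurable
    _ = _ := by
        refine lintegral_congr fun ζ => ?_
        rw [liberaKernel, lintegral_const_mul]
        exact (by fun_prop : Measurable fun t : ℝ => ENNReal.ofReal ((1 - t)⁻¹)).mul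
          (hW.comp (by fun_prop))

/-- A weight on the disk, extended by zero. -/
noncomputable def diskWeight (w : ℝ → ℝ) : ℂ → ℝ≥0∞ :=
  unitDisk.indicator fun z => ENNReal.ofReal (w ‖z‖)

lemma measurable_diskWeight {w : ℝ → ℝ} (hw : Measurable w) : Measurable (diskWeight w) :=
  (hw.comp measurable_norm).ennreal_ofReal.indicator measurableSet_unitDisk

lemma lintegral_deriv_ne_top {v : ℝ → ℝ} (hv : Measurable v) {c : ℝ} (hc : 0 < c)
    (hcv : ∀ r, 0 ≤ r → r < 1 → c ≤ v r) {f : ℂ → ℂ} (hf : f ∈ weightedBlochOne v) :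
    ∫⁻ z in unitDisk, ‖deriv f z‖ₑ ≠ ∞ := by
  have h := ((mem_weightedBlochOne_iff hv fun r h0 h1 => hc.le.trans (hcv r h0 h1)).1 hf).2
  have hle : (∫⁻ z in unitDisk, ‖deriv f z‖ₑ) * ENNReal.ofReal c ≤
      ∫⁻ z in unitDisk, ‖deriv f z‖ₑ * ENNReal.ofReal (v ‖z‖) := by
    rw [← lintegral_mul_const _ (measurable_deriv f).enorm]
    refine setLIntegral_mono' measurableSet_unitDisk fun z hz => ?_
    gcongr
    exact hcv _ (norm_nonneg z) (norm_lt_one_of_mem hz)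
  intro htop
  rw [htop, ENNReal.top_mul (by simpa using hc)] at hle
  exact (hle.trans_lt h).ne rfl

/-- The Libera transform is well defined on `𝔅¹` with a weight bounded from below. -/
lemma liberaWellDefined_of_mem {v : ℝ → ℝ} (hv : Measurable v) {c : ℝ} (hc : 0 < c)
    (hcv : ∀ r, 0 ≤ r → r < 1 → c ≤ v r) {f : ℂ → ℂ} (hf : f ∈ weightedBlochOne v) :
    LiberaWellDefined f :=
  liberaWellDefined_of_summable hf.1
    (summable_taylorCoeff_div hf.1 (lintegral_deriv_ne_top hv hc hcv hf))

/-- A bound for the kernel gives boundedness of the Libera transform between weighted spaces. -/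
lemma libera_mem_of_liberaKernel_le {v w : ℝ → ℝ} (hv : Measurable v) (hw : Measurable w)
    {c C : ℝ} (hc : 0 < c) (hcv : ∀ r, 0 ≤ r → r < 1 → c ≤ v r)
    (hwpos : ∀ r, 0 ≤ r → r < 1 → 0 ≤ w r) (hC : 0 ≤ C)
    (hK : ∀ ζ ∈ unitDisk, liberaKernel (diskWeight w) ζ ≤ ENNReal.ofReal (C * v ‖ζ‖))
    {f : ℂ → ℂ} (hf : f ∈ weightedBlochOne v) : libera f ∈ weightedBlochOne w := by
  have hs := summable_taylorCoeff_div hf.1 (lintegral_deriv_ne_top hv hc hcv hf)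
  have hfin := ((mem_weightedBlochOne_iff hv fun r h0 h1 => hc.le.trans (hcv r h0 h1)).1 hf).2
  rw [mem_weightedBlochOne_iff hw hwpos]
  refine ⟨fun z hz => (hasDerivAt_libera hf.1 hs hz).differentiableAt.differentiableWithinAt, ?_⟩
  set h : ℂ → ℝ≥0∞ := unitDisk.indicator fun z => ‖deriv f z‖ₑ with hh
  have hhm : Measurable h := (measurable_deriv f).enorm.indicator measurableSet_unitDisk
  calc ∫⁻ z in unitDisk, ‖deriv (libera f) z‖ₑ * ENNReal.ofReal (w ‖z‖)
      ≤ ∫⁻ z in unitDisk, (∫⁻ t in Ioo (0 : ℝ) 1,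
          h (t + (1 - t) * z) * ENNReal.ofReal (1 - t)) * diskWeight w z := by
        refine setLIntegral_mono' measurableSet_unitDisk fun z hz => ?_
        rw [(hasDerivAt_libera hf.1 hs hz).deriv, diskWeight, indicator_of_mem hz]
        gcongr
        refine (enorm_integral_le_lintegral_enorm _).trans
          (setLIntegral_mono' measurableSet_Ioo fun t ht => ?_)
        rw [hh, indicator_of_mem (add_mul_mem_unitDisk ht hz), enorm_mul,
          ← Complex.ofReal_one, ← Complex.ofReal_sub, ← ofReal_norm (((1 - t : ℝ) : ℂ)),
          Complex.norm_of_nonneg (sub_pos.2 ht.2).le]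
    _ ≤ ∫⁻ z, (∫⁻ t in Ioo (0 : ℝ) 1,
          h (t + (1 - t) * z) * ENNReal.ofReal (1 - t)) * diskWeight w z :=
        setLIntegral_le_lintegral _ _
    _ = ∫⁻ ζ, h ζ * liberaKernel (diskWeight w) ζ :=
        lintegral_mul_liberaKernel hhm (measurable_diskWeight hw)
    _ ≤ ∫⁻ ζ, unitDisk.indicator
          (fun ζ => ENNReal.ofReal C * (‖deriv f ζ‖ₑ * ENNReal.ofReal (v ‖ζ‖))) ζ := by
        refine lintegral_mono fun ζ => ?_
        by_cases hζ : ζ ∈ unitDisk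
        · rw [hh, indicator_of_mem hζ, indicator_of_mem hζ]
          calc _ ≤ ‖deriv f ζ‖ₑ * ENNReal.ofReal (C * v ‖ζ‖) := by gcongr; exact hK ζ hζ
            _ = _ := by rw [ENNReal.ofReal_mul hC]; ring
        · simp [hh, hζ]
    _ = ENNReal.ofReal C * ∫⁻ ζ in unitDisk, ‖deriv f ζ‖ₑ * ENNReal.ofReal (v ‖ζ‖) := by
        rw [lintegral_indicator measurableSet_unitDisk, lintegral_const_mul]
        exact (measurable_deriv f).enorm.mul (hv.comp measurable_norm).ennreal_ofReal
    _ < ∞ := ENNReal.mul_lt_top ENNReal.ofReal_lt_top hfin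

/-! ### The logarithmic integral and the geometry of `(ζ - t) / (1 - t)`. -/

/-- Substitute `s = log (4 (1 - t) / δ)`, so `ds = -dt / (1 - t)`. The constant `4` keeps `s ≥ log 2
> 0` up to `t = 1 - δ / 2`, away from the singularity of `s^β` at `0`. -/
lemma lintegral_inv_mul_comp_log {δ : ℝ} (hδ0 : 0 < δ) (hδ1 : δ ≤ 1) {φ Φ : ℝ → ℝ}
    (hΦ : ∀ s, 0 < s → HasDerivAt Φ (φ s) s) (hφ : ContinuousOn φ (Ioi 0))
    (hφ0 : ∀ s, 0 < s → 0 ≤ φ s) :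
    ∫⁻ t in Ioo (0 : ℝ) (1 - δ / 2),
        ENNReal.ofReal ((1 - t)⁻¹ * φ (Real.log (4 * (1 - t) / δ))) =
      ENNReal.ofReal (Φ (Real.log (4 / δ)) - Φ (Real.log 2)) := by
  have hb : (0 : ℝ) ≤ 1 - δ / 2 := by linarith
  have h1 : ∀ t ∈ Icc (0 : ℝ) (1 - δ / 2), 0 < 1 - t := fun t ht => by linarith [ht.2]
  have h4 : ∀ t ∈ Icc (0 : ℝ) (1 - δ / 2), 1 < 4 * (1 - t) / δ := fun t ht => by
    rw [lt_div_iff₀ hδ0]; linarith [ht.2]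
  have hcont : ContinuousOn (fun t => (1 - t)⁻¹ * φ (Real.log (4 * (1 - t) / δ)))
      (Icc (0 : ℝ) (1 - δ / 2)) := by
    refine ContinuousOn.mul (ContinuousOn.inv₀ (by fun_prop) fun t ht => (h1 t ht).ne') ?_
    refine hφ.comp (ContinuousOn.log (by fun_prop) fun t ht => ?_) fun t ht => ?_
    · exact (zero_lt_one.trans (h4 t ht)).ne'
    · exact Real.log_pos (h4 t ht)
  have hderiv : ∀ t ∈ uIcc (0 : ℝ) (1 - δ / 2),
      HasDerivAt (fun t => -Φ (Real.log (4 * (1 - t) / δ)))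
        ((1 - t)⁻¹ * φ (Real.log (4 * (1 - t) / δ))) t := by
    intro t ht
    rw [uIcc_of_le hb] at ht
    have h0 := (h1 t ht).ne'
    have hin : HasDerivAt (fun t : ℝ => 4 * (1 - t) / δ) (4 * (-1) / δ) t :=
      ((((hasDerivAt_id t).const_sub 1).const_mul 4).div_const δ)
    have hl := hin.log (zero_lt_one.trans (h4 t ht)).ne'
    have := (HasDerivAt.comp (h₂ := Φ)
      (h := fun t : ℝ => Real.log (4 * (1 - t) / δ)) t (hΦ _ (Real.log_pos (h4 t ht))) hl).neg
    refine this.congr_deriv ?_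
    field_simp
  rw [restrict_Ioo_eq_restrict_Ioc,
    ← ofReal_integral_eq_lintegral_ofReal,
    ← intervalIntegral.integral_of_le hb, intervalIntegral.integral_eq_sub_of_hasDerivAt hderiv]
  · congr 1
    rw [show 4 * (1 - (1 - δ / 2)) / δ = 2 by field_simp; ring]
    simp
    ring
  · exact hcont.intervalIntegrable_of_Icc hb
  · exact (hcont.integrableOn_Icc).mono_set Ioc_subset_Icc_self
  · filter_upwards [ae_restrict_mem measurableSet_Ioc] with t ht
    have ht' := Ioc_subset_Icc_self ht
    exact mul_nonneg (inv_nonneg.2 (h1 t ht').le) (hφ0 _ (Real.log_pos (h4 t ht')))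

section Geometry

variable {ζ : ℂ} {t : ℝ}

lemma norm_sub_lt_of_div_mem (ht : t ∈ Ioo (0 : ℝ) 1)
    (hz : (ζ - t) / (1 - t) ∈ unitDisk) : ‖ζ - t‖ < 1 - t := by
  have h0 : 0 < 1 - t := sub_pos.2 ht.2
  have := norm_lt_one_of_mem hz
  rwa [norm_div, ← Complex.ofReal_one, ← Complex.ofReal_sub, Complex.norm_of_nonneg h0.le,
    div_lt_one h0] at this

lemma norm_div_eq (ht : t ∈ Ioo (0 : ℝ) 1) : ‖(ζ - t) / (1 - t)‖ = ‖ζ - t‖ / (1 - t) := by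
  have h0 : 0 < 1 - t := sub_pos.2 ht.2
  rw [norm_div, ← Complex.ofReal_one, ← Complex.ofReal_sub, Complex.norm_of_nonneg h0.le]

lemma lt_one_sub_half_of_div_mem (ht : t ∈ Ioo (0 : ℝ) 1)
    (hz : (ζ - t) / (1 - t) ∈ unitDisk) : t < 1 - (1 - ‖ζ‖) / 2 := by
  have h := norm_sub_lt_of_div_mem ht hz
  have h1 : t ≤ ‖ζ‖ + ‖ζ - t‖ := by
    calc t = ‖ζ - (ζ - t)‖ := by rw [sub_sub_cancel, Complex.norm_of_nonneg ht.1.le]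
      _ ≤ _ := norm_sub_le _ _
  linarith

lemma one_sub_norm_div_le (ht : t ∈ Ioo (0 : ℝ) 1) :
    1 - ‖(ζ - t) / (1 - t)‖ ≤ (1 - ‖ζ‖) / (1 - t) := by
  have h0 : 0 < 1 - t := sub_pos.2 ht.2
  have h1 : ‖ζ‖ ≤ ‖ζ - t‖ + t := by
    calc ‖ζ‖ = ‖(ζ - t) + t‖ := by rw [sub_add_cancel]
      _ ≤ ‖ζ - t‖ + ‖(t : ℂ)‖ := norm_add_le _ _
      _ = _ := by rw [Complex.norm_of_nonneg ht.1.le]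
  rw [norm_div_eq ht, le_div_iff₀ h0, sub_mul, div_mul_cancel₀ _ h0.ne']
  linarith

/-- The point where the support of `t ↦ W ((ζ - t) / (1 - t))` ends. -/
noncomputable def liberaEndpoint (ζ : ℂ) : ℝ := (1 - ‖ζ‖ ^ 2) / (2 * (1 - ζ.re))

lemma le_one_sub_norm_div (hζ : ζ ∈ unitDisk) (ht : t ∈ Ioo (0 : ℝ) 1)
    (hz : (ζ - t) / (1 - t) ∈ unitDisk) :
    0 < liberaEndpoint ζ - t ∧
      (1 - ‖ζ‖) * (liberaEndpoint ζ - t) ≤ 1 - ‖(ζ - t) / (1 - t)‖ := by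
  have h0 : 0 < 1 - t := sub_pos.2 ht.2
  have hc : 1 - ‖ζ‖ ≤ 1 - ζ.re := by linarith [Complex.re_le_norm ζ]
  have hδ : 0 < 1 - ‖ζ‖ := by linarith [norm_lt_one_of_mem hζ]
  have hcpos : 0 < 1 - ζ.re := hδ.trans_le hc
  have hlt := norm_sub_lt_of_div_mem ht hz
  have hsq : ‖ζ - t‖ ^ 2 = ‖ζ‖ ^ 2 - 2 * t * ζ.re + t ^ 2 := by
    rw [Complex.sq_norm, Complex.sq_norm, Complex.normSq_apply, Complex.normSq_apply]
    simp only [Complex.sub_re, Complex.sub_im, Complex.ofReal_re, Complex.ofReal_im]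
    ring
  have hs : 2 * (1 - ζ.re) * (liberaEndpoint ζ - t) = (1 - t) ^ 2 - ‖ζ - t‖ ^ 2 := by
    rw [hsq, liberaEndpoint]
    field_simp
    ring
  have hpos : 0 < (1 - t) ^ 2 - ‖ζ - t‖ ^ 2 :=
    sub_pos.2 (pow_lt_pow_left₀ hlt (norm_nonneg _) two_ne_zero)
  have hs0 : 0 < liberaEndpoint ζ - t := by
    rw [← hs] at hpos
    exact pos_of_mul_pos_right hpos (by linarith)
  refine ⟨hs0, ?_⟩
  rw [norm_div_eq ht]
  set N := ‖ζ - t‖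
  set s := liberaEndpoint ζ - t
  have hN : 0 ≤ N := norm_nonneg _
  have hcs : (1 - ζ.re) * s ≤ (1 - t - N) / (1 - t) := by
    rw [le_div_iff₀ h0]
    -- By `hs`, `2 (1 - Re ζ) s = (1 - t - N)(1 - t + N)`, and `N < 1 - t`.
    have h5 : (1 - ζ.re) * s ≤ (1 - t - N) * (1 - t) := by nlinarith
    have h6 : 0 ≤ (1 - ζ.re) * s := by positivity
    nlinarith [ht.1]
  calc (1 - ‖ζ‖) * s ≤ (1 - ζ.re) * s := by gcongr
    _ ≤ _ := hcs
    _ = _ := by field_simp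

end Geometry

/-! ### Kernel bounds for logarithmic weights. -/

lemma liberaKernel_le_lintegral {w : ℝ → ℝ} {ζ : ℂ} {B : ℝ → ℝ≥0∞}
    (h : ∀ t ∈ Ioo (0 : ℝ) 1, (ζ - t) / (1 - t) ∈ unitDisk →
      ENNReal.ofReal ((1 - t)⁻¹ * w ‖(ζ - t) / (1 - t)‖) ≤ B t) :
    liberaKernel (diskWeight w) ζ ≤ ∫⁻ t, B t := by
  refine le_trans (setLIntegral_mono' measurableSet_Ioo fun t ht => ?_)
    (setLIntegral_le_lintegral (Ioo 0 1) B)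
  by_cases hz : (ζ - t) / (1 - t) ∈ unitDisk
  · rw [diskWeight, indicator_of_mem hz,
      ← ENNReal.ofReal_mul (inv_nonneg.2 (sub_pos.2 ht.2).le)]
    exact h t ht hz
  · simp [diskWeight, hz]

lemma log_two_le_log_div {r : ℝ} (h0 : 0 ≤ r) (h1 : r < 1) :
    Real.log 2 ≤ Real.log (2 / (1 - r)) := by
  have : 0 < 1 - r := sub_pos.2 h1
  refine Real.log_le_log two_pos ?_
  rw [le_div_iff₀ this]
  linarith

lemma liberaKernel_log_le_of_nonpos {β : ℝ} (hβ : β ≤ 0) {Φ : ℝ → ℝ}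
    (hΦ : ∀ s, 0 < s → HasDerivAt Φ (s ^ β) s) {ζ : ℂ} (hζ : ζ ∈ unitDisk) :
    liberaKernel (diskWeight fun r => Real.log (2 / (1 - r)) ^ β) ζ ≤
      ENNReal.ofReal ((1 / 2) ^ β * (Φ (Real.log (4 / (1 - ‖ζ‖))) - Φ (Real.log 2))) := by
  have hδ0 : 0 < 1 - ‖ζ‖ := sub_pos.2 (norm_lt_one_of_mem hζ)
  have hδ1 : 1 - ‖ζ‖ ≤ 1 := by linarith [norm_nonneg ζ]
  have hI := lintegral_inv_mul_comp_log hδ0 hδ1 hΦ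
    (fun s hs => (Real.continuousAt_rpow_const s β (Or.inl (ne_of_gt hs))).continuousWithinAt)
    fun s hs => Real.rpow_nonneg hs.le _
  rw [ENNReal.ofReal_mul (by positivity), ← hI,
    ← lintegral_const_mul' _ _ ENNReal.ofReal_ne_top, ← lintegral_indicator measurableSet_Ioo]
  refine liberaKernel_le_lintegral fun t ht hz => ?_
  have h0 : 0 < 1 - t := sub_pos.2 ht.2
  have htb := lt_one_sub_half_of_div_mem ht hz
  rw [indicator_of_mem (show t ∈ Ioo (0 : ℝ) (1 - (1 - ‖ζ‖) / 2) from ⟨ht.1, htb⟩),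
    ← ENNReal.ofReal_mul (by positivity)]
  refine ENNReal.ofReal_le_ofReal ?_
  have hle := one_sub_norm_div_le (ζ := ζ) ht
  set q := ‖(ζ - t) / (1 - t)‖ with hq
  have hq0 : 0 ≤ q := norm_nonneg _
  have hq1 : 0 < 1 - q := sub_pos.2 (norm_lt_one_of_mem hz)
  have hx : 1 < 4 * (1 - t) / (1 - ‖ζ‖) := by
    rw [lt_div_iff₀ hδ0]; linarith
  -- Squaring `2 / (1 - q)` pays for the constant `4`; the cost is the factor `(1 / 2) ^ β`.
  have hhalf : 1 / 2 * Real.log (4 * (1 - t) / (1 - ‖ζ‖)) ≤ Real.log (2 / (1 - q)) := by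
    have h5 : 4 * (1 - t) / (1 - ‖ζ‖) ≤ (2 / (1 - q)) ^ 2 := by
      rw [le_div_iff₀ h0] at hle
      rw [div_pow, div_le_div_iff₀ hδ0 (by positivity)]
      have h6 : (1 - q) * ((1 - q) * (1 - t)) ≤ 1 * (1 - ‖ζ‖) := by gcongr; linarith
      nlinarith
    have := Real.log_le_log (zero_lt_one.trans hx) h5
    rw [Real.log_pow] at this
    push_cast at this
    linarith
  have hlog := Real.log_pos hx
  calc (1 - t)⁻¹ * Real.log (2 / (1 - q)) ^ β
      ≤ (1 - t)⁻¹ * (1 / 2 * Real.log (4 * (1 - t) / (1 - ‖ζ‖))) ^ β := by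
        gcongr ?_ * ?_
        exact Real.rpow_le_rpow_of_nonpos (by positivity) hhalf hβ
    _ = _ := by rw [Real.mul_rpow (by norm_num) hlog.le]; ring

lemma lintegral_Ioo_rpow_neg_half {δ : ℝ} (hδ : 0 < δ) :
    ∫⁻ s in Ioo (0 : ℝ) δ, ENNReal.ofReal ((δ / s) ^ (1 / 2 : ℝ)) = ENNReal.ofReal (2 * δ) := by
  have h1 : ∀ s ∈ Ioo (0 : ℝ) δ, ENNReal.ofReal ((δ / s) ^ (1 / 2 : ℝ)) =
      ENNReal.ofReal (δ ^ (1 / 2 : ℝ)) * ENNReal.ofReal (s ^ (-(1 / 2) : ℝ)) := by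
    intro s hs
    rw [← ENNReal.ofReal_mul (by positivity), Real.div_rpow hδ.le hs.1.le,
      Real.rpow_neg hs.1.le, div_eq_mul_inv]
  rw [setLIntegral_congr_fun measurableSet_Ioo h1, lintegral_const_mul' _ _ ENNReal.ofReal_ne_top,
    restrict_Ioo_eq_restrict_Ioc, ← ofReal_integral_eq_lintegral_ofReal,
    ← intervalIntegral.integral_of_le hδ.le, integral_rpow (Or.inl (by norm_num)),
    ← ENNReal.ofReal_mul (by positivity)]
  · congr 1
    rw [Real.zero_rpow (by norm_num), show (-(1 / 2) + 1 : ℝ) = 1 / 2 by norm_num]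
    have : δ ^ (1 / 2 : ℝ) * δ ^ (1 / 2 : ℝ) = δ := by
      rw [← Real.rpow_add hδ]; norm_num
    linear_combination 2 * this
  · exact (intervalIntegral.intervalIntegrable_rpow' (by norm_num)).1
  · filter_upwards [ae_restrict_mem measurableSet_Ioc] with s hs
    exact Real.rpow_nonneg hs.1.le _

/-- The exponent `1 / (2β)` in `log x ≤ 2β x^(1/(2β))` is chosen so that the `β`-th power leaves
`x^(1/2)`, integrable for `x = δ / s` near `s = 0`. -/
lemma add_log_rpow_le {β A x : ℝ} (hβ : 0 < β) (hA : Real.log 2 ≤ A) (hx : 1 ≤ x) :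
    (2 * A + Real.log x) ^ β ≤ (2 + 2 * β / Real.log 2) ^ β * A ^ β * x ^ (1 / 2 : ℝ) := by
  have hl2 : 0 < Real.log 2 := Real.log_pos one_lt_two
  have hA0 : 0 < A := hl2.trans_le hA
  have hx0 : 0 < x := zero_lt_one.trans_le hx
  have hε : 0 < 1 / (2 * β) := by positivity
  have h1 : Real.log x ≤ x ^ (1 / (2 * β)) / (1 / (2 * β)) := Real.log_le_rpow_div hx0.le hε
  have h2 : 1 ≤ x ^ (1 / (2 * β)) := Real.one_le_rpow hx hε.le
  have h3 : 2 * A + Real.log x ≤ (2 + 2 * β / Real.log 2) * A * x ^ (1 / (2 * β)) := by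
    have h4 : 2 * β ≤ 2 * β / Real.log 2 * A := by
      rw [div_mul_eq_mul_div, le_div_iff₀ hl2]; gcongr
    rw [div_div_eq_mul_div, div_one] at h1
    nlinarith [mul_le_mul_of_nonneg_right h4 (zero_le_one.trans h2)]
  have h5 : 0 ≤ 2 * A + Real.log x := add_nonneg (by positivity) (Real.log_nonneg hx)
  calc _ ≤ ((2 + 2 * β / Real.log 2) * A * x ^ (1 / (2 * β))) ^ β := by gcongr
    _ = _ := by
      rw [Real.mul_rpow (by positivity) (by positivity), Real.mul_rpow (by positivity) hA0.le,
        ← Real.rpow_mul hx0.le]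
      congr 2
      field_simp

/-- The weight now blows up where `z` reaches the circle, at the end of the support. Away from that
end (`B₁`) the logarithm is at most `2A`; within distance `δ` of it (`B₂`) the factor `(1 - t)⁻¹` is
at most `2 / δ`, and the singularity is integrable over an interval of length `δ`. -/
lemma liberaKernel_log_le_of_pos {β : ℝ} (hβ : 0 < β) :
    ∃ C, 0 ≤ C ∧ ∀ ζ ∈ unitDisk,
      liberaKernel (diskWeight fun r => Real.log (2 / (1 - r)) ^ β) ζ ≤
        ENNReal.ofReal (C * Real.log (2 / (1 - ‖ζ‖)) ^ (β + 1)) := by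
  have hl2 : 0 < Real.log 2 := Real.log_pos one_lt_two
  set M : ℝ := (2 + 2 * β / Real.log 2) ^ β with hM
  have hM0 : 0 ≤ M := by positivity
  refine ⟨2 ^ β + 4 * M / Real.log 2, by positivity, fun ζ hζ => ?_⟩
  have hζ1 := norm_lt_one_of_mem hζ
  set δ : ℝ := 1 - ‖ζ‖ with hδ
  have hδ0 : 0 < δ := sub_pos.2 hζ1
  have hδ1 : δ ≤ 1 := by linarith [norm_nonneg ζ]
  set A : ℝ := Real.log (2 / δ) with hA
  have hA2 : Real.log 2 ≤ A := log_two_le_log_div (norm_nonneg ζ) hζ1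
  have hA0 : 0 < A := hl2.trans_le hA2
  have hI := lintegral_inv_mul_comp_log hδ0 hδ1 (φ := fun _ => 1) (Φ := id)
    (fun s _ => hasDerivAt_id s) continuousOn_const fun _ _ => zero_le_one
  have hIA : id (Real.log (4 / δ)) - id (Real.log 2) = A := by
    rw [id, id, ← Real.log_div (by positivity) two_ne_zero, hA]
    congr 1
    field_simp
    norm_num
  simp only [mul_one] at hI
  rw [hIA] at hI
  set B₁ : ℝ → ℝ≥0∞ := (Ioo (0 : ℝ) (1 - δ / 2)).indicator fun t =>
    ENNReal.ofReal ((2 * A) ^ β) * ENNReal.ofReal ((1 - t)⁻¹) with hB₁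
  set B₂ : ℝ → ℝ≥0∞ := (Ioo (0 : ℝ) δ).indicator fun s =>
    ENNReal.ofReal (2 / δ * (M * A ^ β)) * ENNReal.ofReal ((δ / s) ^ (1 / 2 : ℝ)) with hB₂
  have hB₁m : Measurable B₁ := Measurable.indicator (by fun_prop) measurableSet_Ioo
  have hI₁ : ∫⁻ t, B₁ t = ENNReal.ofReal ((2 * A) ^ β * A) := by
    rw [hB₁, lintegral_indicator measurableSet_Ioo, lintegral_const_mul' _ _ ENNReal.ofReal_ne_top,
      hI, ENNReal.ofReal_mul (by positivity)]
  have hI₂ : ∫⁻ t, B₂ (liberaEndpoint ζ - t) = ENNReal.ofReal (4 * M * A ^ β) := by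
    rw [lintegral_sub_left_eq_self, hB₂, lintegral_indicator measurableSet_Ioo,
      lintegral_const_mul' _ _ ENNReal.ofReal_ne_top, lintegral_Ioo_rpow_neg_half hδ0,
      ← ENNReal.ofReal_mul (by positivity)]
    congr 1
    field_simp
    ring
  calc liberaKernel (diskWeight fun r => Real.log (2 / (1 - r)) ^ β) ζ
      ≤ ∫⁻ t, (B₁ t + B₂ (liberaEndpoint ζ - t)) := by
        refine liberaKernel_le_lintegral fun t ht hz => ?_
        have h0 : 0 < 1 - t := sub_pos.2 ht.2
        have htb : t < 1 - δ / 2 := lt_one_sub_half_of_div_mem ht hz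
        obtain ⟨hs0, hsle⟩ := le_one_sub_norm_div hζ ht hz
        rw [← hδ] at hsle
        set s := liberaEndpoint ζ - t with hs
        set q := ‖(ζ - t) / (1 - t)‖ with hq
        have hq1 : q < 1 := norm_lt_one_of_mem hz
        have hq0 : 0 < 1 - q := sub_pos.2 hq1
        have hlog0 : 0 < Real.log (2 / (1 - q)) :=
          hl2.trans_le (log_two_le_log_div (norm_nonneg _) hq1)
        have hδs : 0 < δ * s := mul_pos hδ0 hs0
        have hlog : Real.log (2 / (1 - q)) ≤ Real.log (2 / (δ * s)) :=
          Real.log_le_log (by positivity) (by gcongr)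
        have h2A : Real.log (2 / δ ^ 2) ≤ 2 * A := by
          have h6 : 2 / δ ^ 2 ≤ (2 / δ) ^ 2 := by
            rw [div_pow]; gcongr; norm_num
          have := Real.log_le_log (by positivity) h6
          rw [Real.log_pow] at this
          exact_mod_cast this
        rcases le_or_gt δ s with hcase | hcase
        · refine le_add_right ?_
          rw [hB₁, indicator_of_mem (show t ∈ Ioo (0 : ℝ) (1 - δ / 2) from ⟨ht.1, htb⟩),
            ← ENNReal.ofReal_mul (by positivity), mul_comm]
          refine ENNReal.ofReal_le_ofReal ?_
          gcongr
          refine hlog.trans (le_trans (Real.log_le_log (by positivity) ?_) h2A)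
          rw [pow_two]
          gcongr
        · refine le_add_left ?_
          rw [hB₂, indicator_of_mem (show s ∈ Ioo (0 : ℝ) δ from ⟨hs0, hcase⟩),
            ← ENNReal.ofReal_mul (by positivity), mul_assoc]
          refine ENNReal.ofReal_le_ofReal ?_
          have hx : 1 ≤ δ / s := by rw [le_div_iff₀ hs0]; linarith
          have h7 : (1 - t)⁻¹ ≤ 2 / δ := by
            rw [inv_le_comm₀ h0 (by positivity), inv_div]; linarith
          have h8 : Real.log (2 / (1 - q)) ≤ 2 * A + Real.log (δ / s) := by
            refine hlog.trans ?_
            rw [show 2 / (δ * s) = 2 / δ ^ 2 * (δ / s) by field_simp,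
              Real.log_mul (by positivity) (by positivity)]
            linarith
          have h9 := add_log_rpow_le hβ hA2 hx
          calc (1 - t)⁻¹ * Real.log (2 / (1 - q)) ^ β
              ≤ 2 / δ * (2 * A + Real.log (δ / s)) ^ β := by gcongr
            _ ≤ 2 / δ * (M * A ^ β * (δ / s) ^ (1 / 2 : ℝ)) := by gcongr
    _ = ENNReal.ofReal ((2 * A) ^ β * A + 4 * M * A ^ β) := by
        rw [lintegral_add_left hB₁m, hI₁, hI₂, ENNReal.ofReal_add (by positivity) (by positivity)]
    _ ≤ _ := by
        refine ENNReal.ofReal_le_ofReal ?_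
        have e : A ^ (β + 1) = A ^ β * A := by rw [Real.rpow_add hA0, Real.rpow_one]
        rw [e, Real.mul_rpow two_pos.le hA0.le, add_mul]
        -- The endpoint contribution is of lower order, and `A ≥ log 2` absorbs it.
        have h10 : 4 * M * A ^ β ≤ 4 * M / Real.log 2 * (A ^ β * A) := by
          rw [div_mul_eq_mul_div, le_div_iff₀ hl2]
          calc 4 * M * A ^ β * Real.log 2 ≤ 4 * M * A ^ β * A := by gcongr
            _ = _ := by ring
        linarith

lemma log_four_div_le {r : ℝ} (h0 : 0 ≤ r) (h1 : r < 1) :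
    Real.log (4 / (1 - r)) ≤ 2 * Real.log (2 / (1 - r)) := by
  have hr : 0 < 1 - r := sub_pos.2 h1
  have : 4 / (1 - r) ≤ (2 / (1 - r)) ^ 2 := by
    rw [div_pow, div_le_div_iff₀ hr (by positivity)]
    nlinarith
  have := Real.log_le_log (by positivity) this
  rw [Real.log_pow] at this
  exact_mod_cast this

lemma liberaKernel_log_le_of_neg_one_lt {β : ℝ} (hβ : -1 < β) (hβ0 : β ≤ 0) :
    ∃ C, 0 ≤ C ∧ ∀ ζ ∈ unitDisk,
      liberaKernel (diskWeight fun r => Real.log (2 / (1 - r)) ^ β) ζ ≤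
        ENNReal.ofReal (C * Real.log (2 / (1 - ‖ζ‖)) ^ (β + 1)) := by
  have hl2 : 0 < Real.log 2 := Real.log_pos one_lt_two
  have hβ1 : 0 < β + 1 := by linarith
  refine ⟨(1 / 2) ^ β * (2 ^ (β + 1) / (β + 1)), by positivity, fun ζ hζ => ?_⟩
  have hζ1 := norm_lt_one_of_mem hζ
  have hA := hl2.trans_le (log_two_le_log_div (norm_nonneg ζ) hζ1)
  have hΦ : ∀ s : ℝ, 0 < s → HasDerivAt (fun s : ℝ => s ^ (β + 1) / (β + 1)) (s ^ β) s := by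
    intro s hs
    refine ((Real.hasDerivAt_rpow_const (p := β + 1) (Or.inl hs.ne')).div_const _).congr_deriv ?_
    rw [add_sub_cancel_right]
    field_simp
  refine (liberaKernel_log_le_of_nonpos hβ0 hΦ hζ).trans (ENNReal.ofReal_le_ofReal ?_)
  rw [mul_assoc]
  gcongr
  have h4 : 0 ≤ Real.log (4 / (1 - ‖ζ‖)) := by
    refine Real.log_nonneg ?_
    rw [le_div_iff₀ (sub_pos.2 hζ1)]; linarith [norm_nonneg ζ]
  have h5 : Real.log (4 / (1 - ‖ζ‖)) ^ (β + 1) ≤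
      2 ^ (β + 1) * Real.log (2 / (1 - ‖ζ‖)) ^ (β + 1) := by
    rw [← Real.mul_rpow two_pos.le hA.le]
    gcongr
    exact log_four_div_le (norm_nonneg ζ) hζ1
  calc _ ≤ Real.log (4 / (1 - ‖ζ‖)) ^ (β + 1) / (β + 1) := sub_le_self _ (by positivity)
    _ ≤ 2 ^ (β + 1) * Real.log (2 / (1 - ‖ζ‖)) ^ (β + 1) / (β + 1) := by gcongr
    _ = _ := by ring

lemma one_lt_log_four : 1 < Real.log 4 := by
  rw [show (4 : ℝ) = 2 ^ 2 by norm_num, Real.log_pow]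
  push_cast
  linarith [Real.log_two_gt_d9]

lemma log_log_four_le {r : ℝ} (h0 : 0 ≤ r) (h1 : r < 1) :
    Real.log (Real.log 4) ≤ Real.log (Real.log (4 / (1 - r))) := by
  have hr : 0 < 1 - r := sub_pos.2 h1
  refine Real.log_le_log (zero_lt_one.trans one_lt_log_four)
    (Real.log_le_log (by norm_num) ?_)
  rw [le_div_iff₀ hr]
  linarith

lemma liberaKernel_log_neg_one_le :
    ∃ C, 0 ≤ C ∧ ∀ ζ ∈ unitDisk,
      liberaKernel (diskWeight fun r => Real.log (2 / (1 - r)) ^ (-1 : ℝ)) ζ ≤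
        ENNReal.ofReal (C * Real.log (Real.log (4 / (1 - ‖ζ‖)))) := by
  have hll : 0 < Real.log (Real.log 4) := Real.log_pos one_lt_log_four
  have hl2 : Real.log (Real.log 2) < 0 :=
    Real.log_neg (Real.log_pos one_lt_two) (by linarith [Real.log_two_lt_d9])
  refine ⟨2 * (1 + -Real.log (Real.log 2) / Real.log (Real.log 4)), ?_, fun ζ hζ => ?_⟩
  · have : 0 < -Real.log (Real.log 2) := neg_pos.2 hl2
    positivity
  have hL := log_log_four_le (norm_nonneg ζ) (norm_lt_one_of_mem hζ)
  refine (liberaKernel_log_le_of_nonpos (by norm_num) (Φ := Real.log) (fun s hs => ?_) hζ).trans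
    (ENNReal.ofReal_le_ofReal ?_)
  · rw [Real.rpow_neg_one]
    exact Real.hasDerivAt_log hs.ne'
  · rw [Real.rpow_neg_one, one_div, inv_inv, mul_assoc]
    gcongr
    set L := Real.log (Real.log (4 / (1 - ‖ζ‖)))
    -- The lower limit contributes the positive constant `-log log 2`, absorbed because `L ≥ log log
    -- 4 > 0`.
    have : -Real.log (Real.log 2) ≤ -Real.log (Real.log 2) / Real.log (Real.log 4) * L := by
      rw [div_mul_eq_mul_div, le_div_iff₀ hll]
      exact mul_le_mul_of_nonneg_left hL (neg_pos.2 hl2).le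
    linarith

lemma liberaKernel_log_le_of_lt_neg_one {β : ℝ} (hβ : β < -1) :
    ∃ C, 0 ≤ C ∧ ∀ ζ ∈ unitDisk,
      liberaKernel (diskWeight fun r => Real.log (2 / (1 - r)) ^ β) ζ ≤ ENNReal.ofReal (C * 1) := by
  have hβ1 : 0 < -(β + 1) := by linarith
  have hne : β + 1 ≠ 0 := by linarith
  have hl2 : 0 < Real.log 2 := Real.log_pos one_lt_two
  refine ⟨(1 / 2) ^ β * (Real.log 2 ^ (β + 1) / -(β + 1)), by positivity, fun ζ hζ => ?_⟩
  have hζ1 := norm_lt_one_of_mem hζ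
  have hΦ : ∀ s : ℝ, 0 < s → HasDerivAt (fun s : ℝ => s ^ (β + 1) / (β + 1)) (s ^ β) s := by
    intro s hs
    refine ((Real.hasDerivAt_rpow_const (p := β + 1) (Or.inl hs.ne')).div_const _).congr_deriv ?_
    rw [add_sub_cancel_right]
    field_simp
  refine (liberaKernel_log_le_of_nonpos (by linarith) hΦ hζ).trans (ENNReal.ofReal_le_ofReal ?_)
  rw [mul_one]
  gcongr
  have h4 : 0 ≤ Real.log (4 / (1 - ‖ζ‖)) := by
    refine Real.log_nonneg ?_
    rw [le_div_iff₀ (sub_pos.2 hζ1)]; linarith [norm_nonneg ζ]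
  -- As `β + 1 < 0`, the upper limit contributes a nonpositive term, leaving a bound independent of
  -- `ζ`.
  have h5 : Real.log (4 / (1 - ‖ζ‖)) ^ (β + 1) / (β + 1) ≤ 0 :=
    div_nonpos_of_nonneg_of_nonpos (by positivity) (by linarith)
  rw [div_neg]
  linarith

lemma measurable_log_weight (β : ℝ) :
    Measurable fun r : ℝ => Real.log (2 / (1 - r)) ^ β := by fun_prop

lemma log_weight_nonneg (β : ℝ) (r : ℝ) (h0 : 0 ≤ r) (h1 : r < 1) :
    0 ≤ Real.log (2 / (1 - r)) ^ β :=
  Real.rpow_nonneg ((Real.log_pos one_lt_two).le.trans (log_two_le_log_div h0 h1)) _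

end LiberaBloch

open LiberaBloch

theorem mainTheorem7 :
    (∀ α : ℝ, 0 < α → ∀ f ∈ LiberaBloch.blochOneLog α,
      LiberaBloch.LiberaWellDefined f ∧
        LiberaBloch.libera f ∈ LiberaBloch.blochOneLog (α - 1)) ∧
    (∀ f ∈ LiberaBloch.blochOneLogg,
      LiberaBloch.LiberaWellDefined f ∧
        LiberaBloch.libera f ∈ LiberaBloch.blochOneLog (-1)) ∧
    (∀ f ∈ LiberaBloch.blochOne,
      LiberaBloch.LiberaWellDefined f ∧
        ∀ α : ℝ, α < -1 → LiberaBloch.libera f ∈ LiberaBloch.blochOneLog α) := by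
  have hl2 : 0 < Real.log 2 := Real.log_pos one_lt_two
  refine ⟨fun α hα f hf => ?_, fun f hf => ?_, fun f hf => ?_⟩
  · have hc : 0 < Real.log 2 ^ α := Real.rpow_pos_of_pos hl2 α
    have hcv : ∀ r : ℝ, 0 ≤ r → r < 1 → Real.log 2 ^ α ≤ Real.log (2 / (1 - r)) ^ α :=
      fun r h0 h1 => Real.rpow_le_rpow hl2.le (log_two_le_log_div h0 h1) hα.le
    refine ⟨liberaWellDefined_of_mem (measurable_log_weight α) hc hcv hf, ?_⟩
    have hker : ∃ C, 0 ≤ C ∧ ∀ ζ ∈ unitDisk,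
        liberaKernel (diskWeight fun r => Real.log (2 / (1 - r)) ^ (α - 1)) ζ ≤
          ENNReal.ofReal (C * Real.log (2 / (1 - ‖ζ‖)) ^ α) := by
      -- The target weight is unbounded near the circle for `α > 1` and bounded for `α ≤ 1`; the two
      -- cases use opposite bounds on `1 - |z|`.
      rcases lt_or_ge 0 (α - 1) with h | h
      · simpa only [sub_add_cancel] using liberaKernel_log_le_of_pos h
      · simpa only [sub_add_cancel] using
          liberaKernel_log_le_of_neg_one_lt (show -1 < α - 1 by linarith) h
    obtain ⟨C, hC, hK⟩ := hker
    exact libera_mem_of_liberaKernel_le (measurable_log_weight α) (measurable_log_weight _) hc hcv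
      (log_weight_nonneg _) hC hK hf
  · have hc : 0 < Real.log (Real.log 4) := Real.log_pos one_lt_log_four
    have hm : Measurable fun r : ℝ => Real.log (Real.log (4 / (1 - r))) := by fun_prop
    have hcv : ∀ r : ℝ, 0 ≤ r → r < 1 →
        Real.log (Real.log 4) ≤ Real.log (Real.log (4 / (1 - r))) := fun r => log_log_four_le
    obtain ⟨C, hC, hK⟩ := liberaKernel_log_neg_one_le
    exact ⟨liberaWellDefined_of_mem hm hc hcv hf,
      libera_mem_of_liberaKernel_le hm (measurable_log_weight _) hc hcv
        (log_weight_nonneg _) hC hK hf⟩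
  · have hcv : ∀ r : ℝ, 0 ≤ r → r < 1 → (1 : ℝ) ≤ 1 := fun _ _ _ => le_rfl
    refine ⟨liberaWellDefined_of_mem measurable_const one_pos hcv hf, fun α hα => ?_⟩
    obtain ⟨C, hC, hK⟩ := liberaKernel_log_le_of_lt_neg_one hα
    exact libera_mem_of_liberaKernel_le measurable_const (measurable_log_weight _) one_pos hcv
      (log_weight_nonneg _) hC hK hf
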